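/- Let $\mathcal{H}=(V,E)$ be a hypergraph: a set $V$ of vertices together with a family of hyperedges indexed by a set $E$, each $e\in E$ being regarded as a subset of $V$ (repeated, empty or infinite hyperedges and isolated vertices are allowed, and $V$, $E$ may be infinite). Its upper closure $\Delta(\mathcal{H})$ is the simplicial complex on $V$ whose simplices are the nonempty finite sets $\sigma\subseteq V$ contained in some hyperedge. Its nerve $\mathrm{Nrv}(\mathcal{H})$ is the simplicial complex on $E$ whose simplices are the nonempty finite sets $\sigma\subseteq E$ with $\bigcap_{e\in\sigma}e\neq\emptyset$. For a simplicial complex $K$ on a totally ordered base set and a field $\mathbb{K}$, let $C_p(K)$ be the $\mathbb{K}$-vector space with basis the $p$-simplices of $K$ (the simplices with $p+1$ vertices), oriented as $[x_0,\dots,x_p]$ with $x_0<\dots<x_p$; let $\partial_p[x_0,\dots,x_p]=\sum_{j=0}^p(-1)^j[x_0,\dots,\widehat{x}_j,\dots,x_p]$ for $p\ge 1$ and $\partial_0=0$; and let $H_p(K)=\ker\partial_p/\operatorname{im}\partial_{p+1}$ be the (unreduced) simplicial homology. The closure homology of $\mathcal{H}$ is $H^{\Delta}_p(\mathcal{H}):=H_p(\Delta(\mathcal{H}))$.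 Proposition. The closure homology of $\mathcal{H}$ is isomorphic to the homology of its nerve: for every field $\mathbb{K}$ (for example $\mathbb{Z}/2\mathbb{Z}$), every choice of total orders on $V$ and on $E$, and every $p\ge 0$, there is an isomorphism of $\mathbb{K}$-vector spaces $$H^{\Delta}_p(\mathcal{H})\;\cong\;H_p(\mathrm{Nrv}(\mathcal{H})).$$ -/

import Mathlib

/-- The quotient `Z / (Z ∩ B)` of two submodules of a module; it is `Z / B` when `B ≤ Z`. -/
abbrev Submodule.Subquotient {R M : Type*} [Ring R] [AddCommGroup M] [Module R M]
    (Z B : Submodule R M) : Type _ :=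
  Z ⧸ B.submoduleOf Z

/-! ### Oriented simplicial chains and simplicial homology of an abstract simplicial complex

The simplices of `K` are nonempty finite sets of vertices.  A total order on the base set orients
every simplex `{x₀ < x₁ < ⋯ < x_p}` as `[x₀, …, x_p]`. -/

namespace PreAbstractSimplicialComplex

/-- The `p`-simplices of `K`: the simplices with `p + 1` vertices. -/
abbrev Simplex {X : Type*} (K : PreAbstractSimplicialComplex X) (p : ℕ) : Type _ :=
  {σ : Finset X // σ ∈ K.faces ∧ σ.card = p + 1}

/-- The space `C_p(K; R)` of `p`-chains: finite formal sums of `p`-simplices of `K`. -/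
abbrev Chain (R : Type*) [CommRing R] {X : Type*} (K : PreAbstractSimplicialComplex X) (p : ℕ) :
    Type _ :=
  K.Simplex p →₀ R

/-- The face of a `(p + 1)`-simplex obtained by removing its vertex `x`. -/
def removeVertex {X : Type*} [DecidableEq X] {K : PreAbstractSimplicialComplex X} {p : ℕ}
    (σ : K.Simplex (p + 1)) (x : X) (hx : x ∈ σ.1) : K.Simplex p :=
  ⟨σ.1.erase x, by
    have hc : (σ.1.erase x).card = p + 1 := by
      rw [Finset.card_erase_of_mem hx, σ.2.2]; rfl
    exact ⟨(K.isRelLowerSet_faces σ.2.1).2 (Finset.erase_subset x σ.1)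
      (Finset.card_pos.mp (by omega)), hc⟩⟩

/-- The position of the vertex `x` in the increasing list of the vertices of `σ`: the number of
vertices of `σ` that precede `x`. -/
def position {X : Type*} [LinearOrder X] (σ : Finset X) (x : X) : ℕ :=
  (σ.filter (fun y => y < x)).card

/-- The boundary of the oriented simplex `[x₀, …, x_{p+1}]`, that is
`∑ j, (-1) ^ j • [x₀, …, x̂_j, …, x_{p+1}]`. -/
noncomputable def simplexBoundary (R : Type*) [CommRing R] {X : Type*} [LinearOrder X]
    {K : PreAbstractSimplicialComplex X} {p : ℕ} (σ : K.Simplex (p + 1)) : K.Chain R p :=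
  ∑ x : {x : X // x ∈ σ.1},
    Finsupp.single (removeVertex σ x.1 x.2) ((-1 : R) ^ position σ.1 x.1)

/-- The boundary map `∂_{p+1} : C_{p+1}(K; R) → C_p(K; R)`. -/
noncomputable def boundary (R : Type*) [CommRing R] {X : Type*} [LinearOrder X]
    (K : PreAbstractSimplicialComplex X) (p : ℕ) : K.Chain R (p + 1) →ₗ[R] K.Chain R p :=
  Finsupp.linearCombination R (simplexBoundary R)

/-- The `p`-cycles `Z_p = ker ∂_p`, where `∂_0 = 0`. -/
noncomputable def cycles (R : Type*) [CommRing R] {X : Type*} [LinearOrder X]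
    (K : PreAbstractSimplicialComplex X) : (p : ℕ) → Submodule R (K.Chain R p)
  | 0 => ⊤
  | p + 1 => LinearMap.ker (boundary R K p)

/-- The `p`-boundaries `B_p = im ∂_{p+1}`. -/
noncomputable def boundaries (R : Type*) [CommRing R] {X : Type*} [LinearOrder X]
    (K : PreAbstractSimplicialComplex X) (p : ℕ) : Submodule R (K.Chain R p) :=
  LinearMap.range (boundary R K p)

/-- The signs of the two ways of removing two vertices cancel. -/
theorem position_sign_cancel (R : Type*) [CommRing R] {X : Type*} [LinearOrder X] (σ : Finset X)
    {x y : X} (hx : x ∈ σ) (hy : y ∈ σ) (hxy : x ≠ y) :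
    (-1 : R) ^ position σ x * (-1) ^ position (σ.erase x) y
      + (-1) ^ position σ y * (-1) ^ position (σ.erase y) x = 0 := by
  wlog h : x < y generalizing x y
  · rw [add_comm]
    exact this hy hx hxy.symm (lt_of_le_of_ne (not_lt.mp h) hxy.symm)
  have h1 : position (σ.erase y) x = position σ x := by
    unfold position
    rw [Finset.filter_erase, Finset.erase_eq_of_notMem]
    simp [h.le]
  have h2 : position σ y = position (σ.erase x) y + 1 := by
    unfold position
    rw [Finset.filter_erase, Finset.card_erase_add_one]
    simp [hx, h]
  rw [h1, h2]
  ring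

/-- The composite of two consecutive boundary maps is zero. -/
theorem boundary_comp_boundary (R : Type*) [CommRing R] {X : Type*} [LinearOrder X]
    (K : PreAbstractSimplicialComplex X) (p : ℕ) :
    boundary R K p ∘ₗ boundary R K (p + 1) = 0 := by
  ext1 σ
  ext1
  simp only [boundary, simplexBoundary, LinearMap.comp_apply, Finsupp.lsingle_apply,
    Finsupp.linearCombination_single, one_smul, map_sum, LinearMap.zero_apply,
    Finset.smul_sum, Finsupp.smul_single, smul_eq_mul]
  rw [Finset.sum_sigma']
  refine Finset.sum_involution
    (fun a _ => ⟨⟨a.2.1, Finset.mem_of_mem_erase a.2.2⟩,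
      ⟨a.1.1, Finset.mem_erase.mpr ⟨(Finset.ne_of_mem_erase a.2.2).symm, a.1.2⟩⟩⟩)
    ?_ ?_ ?_ ?_
  · rintro ⟨⟨x, hx⟩, ⟨y, hy⟩⟩ -
    have hyx : y ≠ x := Finset.ne_of_mem_erase hy
    have hy' : y ∈ σ.1 := Finset.mem_of_mem_erase hy
    have key : removeVertex (removeVertex σ x hx) y hy
        = removeVertex (removeVertex σ y hy') x (Finset.mem_erase.mpr ⟨hyx.symm, hx⟩) :=
      Subtype.ext (Finset.erase_right_comm)
    dsimp only
    rw [key, ← Finsupp.single_add]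
    have := position_sign_cancel R σ.1 hx hy' hyx.symm
    simp only [removeVertex]
    rw [this, Finsupp.single_zero]
  · rintro ⟨⟨x, hx⟩, ⟨y, hy⟩⟩ - - h
    have hyx : y ≠ x := Finset.ne_of_mem_erase hy
    exact hyx (congrArg (fun a => a.1.1) h)
  · intro a _
    simp
  · rintro ⟨⟨x, hx⟩, ⟨y, hy⟩⟩ -
    rfl

/-- Every boundary is a cycle. -/
theorem boundaries_le_cycles (R : Type*) [CommRing R] {X : Type*} [LinearOrder X]
    (K : PreAbstractSimplicialComplex X) (p : ℕ) : boundaries R K p ≤ cycles R K p := by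
  cases p with
  | zero => exact le_top
  | succ p => exact LinearMap.range_le_ker_iff.mpr (boundary_comp_boundary R K p)

/-- The `p`-th simplicial homology `H_p(K; R) = Z_p / B_p`. -/
abbrev Homology (R : Type*) [CommRing R] {X : Type*} [LinearOrder X]
    (K : PreAbstractSimplicialComplex X) (p : ℕ) : Type _ :=
  Submodule.Subquotient (cycles R K p) (boundaries R K p)

end PreAbstractSimplicialComplex

/-! ### Hypergraphs, their upper closure and their nerve -/

/-- A hypergraph with vertex set `V` whose hyperedges form a family of subsets of `V` indexed by
`E`.  Multiple edges, empty edges and isolated vertices are allowed. -/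
structure IndexedHypergraph (V E : Type*) where
  /-- The set of vertices of a hyperedge. -/
  edge : E → Set V

namespace IndexedHypergraph

/-- The upper closure `Δ(H)`: its simplices are the (nonempty, finite) subsets of the hyperedges. -/
def upperClosure {V E : Type*} (H : IndexedHypergraph V E) : PreAbstractSimplicialComplex V where
  faces := {σ | σ.Nonempty ∧ ∃ e : E, (σ : Set V) ⊆ H.edge e}
  isRelLowerSet_faces := by
    rintro σ ⟨hσ, e, he⟩
    exact ⟨hσ, fun τ hτ hne => ⟨hne, e, (Finset.coe_subset.mpr hτ).trans he⟩⟩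

/-- The nerve `Nrv(H)`: its simplices are the (nonempty, finite) sets of hyperedges with nonempty
intersection. -/
def nerve {V E : Type*} (H : IndexedHypergraph V E) : PreAbstractSimplicialComplex E where
  faces := {σ | σ.Nonempty ∧ (⋂ e ∈ σ, H.edge e).Nonempty}
  isRelLowerSet_faces := by
    rintro σ ⟨hσ, hv⟩
    exact ⟨hσ, fun τ hτ hne => ⟨hne, hv.mono (Set.biInter_subset_biInter_left hτ)⟩⟩

/-- The closure homology of `H` in degree `p`: the homology of its upper closure. -/
abbrev ClosureHomology (R : Type*) [CommRing R] {V E : Type*} [LinearOrder V]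
    (H : IndexedHypergraph V E) (p : ℕ) : Type _ :=
  H.upperClosure.Homology R p

end IndexedHypergraph

/-! This is Dowker duality, proved through a complex containing both sides. On `V ⊕ₗ E`, `incidence`
consists of finite sets of vertices and hyperedges that are mutually incident. Its nonempty members
with vertices only are the simplices of the upper closure, those with hyperedges only the simplices
of the nerve. Each of the two inclusions induces an isomorphism in homology.

For this, let `S` be one of the two halves. All members with the same nonempty part outside of `S`
can be enlarged by one common apex in `S`: a common vertex of the hyperedges, or a common hyperedge
of the vertices. Adding the apex is a contracting homotopy up to sets with fewer elements outside of
`S` (`homotopy_single_mem_filtration`). By induction on that number, a chain whose boundary lives in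
`S` can be moved into `S` by subtracting a boundary (`exists_sub_boundary_mem_filtration_zero`).
Applied to cycles this gives surjectivity, applied to bounding chains injectivity
(`nonempty_homology_equiv`). -/

open PreAbstractSimplicialComplex

/-! ### Isomorphisms of subquotients -/

/-- A linear map that respects two subquotients, is onto modulo the second denominator and reflects
it, induces an isomorphism of the subquotients. -/
theorem Submodule.nonempty_subquotient_equiv {R M N : Type*} [Ring R] [AddCommGroup M] [Module R M]
    [AddCommGroup N] [Module R N] (f : M →ₗ[R] N) {Z B : Submodule R M} {Z' B' : Submodule R N}
    (hZ : ∀ z ∈ Z, f z ∈ Z') (hB : ∀ z ∈ Z, z ∈ B ↔ f z ∈ B')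
    (hsurj : ∀ z' ∈ Z', ∃ z ∈ Z, z' - f z ∈ B') :
    Nonempty (Submodule.Subquotient Z B ≃ₗ[R] Submodule.Subquotient Z' B') := by
  let g : Z →ₗ[R] Submodule.Subquotient Z' B' := (B'.submoduleOf Z').mkQ ∘ₗ f.restrict hZ
  have hker : LinearMap.ker g = B.submoduleOf Z := by
    ext z
    exact (Submodule.Quotient.mk_eq_zero _).trans (hB z z.2).symm
  have hg : Function.Surjective g := by
    intro y
    obtain ⟨z', rfl⟩ := Submodule.mkQ_surjective _ y
    obtain ⟨z, hz, hzz⟩ := hsurj z' z'.2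
    refine ⟨⟨z, hz⟩, Eq.symm ?_⟩
    simp only [g, LinearMap.comp_apply, Submodule.mkQ_apply]
    rw [Submodule.Quotient.eq]
    simpa [Submodule.submoduleOf] using hzz
  exact ⟨(Submodule.quotEquivOfEq _ _ hker.symm).trans (g.quotKerEquivOfSurjective hg)⟩

/-- To check that a linear map sends finitely supported functions supported in `s` into `N`, it
suffices to check it on the basis elements. -/
theorem Finsupp.map_mem_of_mem_supported {R α M : Type*} [CommRing R] [AddCommGroup M] [Module R M]
    {s : Set α} {N : Submodule R M} (f : (α →₀ R) →ₗ[R] M)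
    (h : ∀ a ∈ s, f (Finsupp.single a 1) ∈ N) {x : α →₀ R} (hx : x ∈ Finsupp.supported R R s) :
    f x ∈ N := by
  rw [Finsupp.supported_eq_span_single] at hx
  refine (Submodule.span_le (p := N.comap f)).2 ?_ hx
  rintro _ ⟨a, ha, rfl⟩
  exact h a ha

/-! ### Formal sums of finite sets

Chains of all simplicial complexes on `X` and of all degrees live in `Finset X →₀ R`. -/

namespace FinsetChain

variable {R : Type*} [CommRing R]

section

variable {X : Type*}

/-- The members of `P` with `n` elements. -/
def level (P : Set (Finset X)) (n : ℕ) : Set (Finset X) := {σ | σ ∈ P ∧ σ.card = n}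

open Classical in
/-- The part of `σ` outside of `S`. -/
noncomputable def outer (S : Set X) (σ : Finset X) : Finset X := σ.filter (· ∉ S)

theorem mem_outer {S : Set X} {σ : Finset X} {x : X} : x ∈ outer S σ ↔ x ∈ σ ∧ x ∉ S := by
  simp [outer]

theorem outer_subset (S : Set X) (σ : Finset X) : outer S σ ⊆ σ := fun _ hx => (mem_outer.1 hx).1

theorem outer_mono (S : Set X) {σ τ : Finset X} (h : σ ⊆ τ) : outer S σ ⊆ outer S τ := fun x => by
  simp only [mem_outer]
  exact And.imp_left (@h x)

variable (R) in
/-- The formal sums of finite sets with at most `k` elements outside of `S`. -/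
noncomputable def filtration (S : Set X) (k : ℕ) : Submodule R (Finset X →₀ R) :=
  Finsupp.supported R R {σ | (outer S σ).card ≤ k}

theorem filtration_mono (S : Set X) {k l : ℕ} (h : k ≤ l) : filtration R S k ≤ filtration R S l :=
  Finsupp.supported_mono fun _ hσ => le_trans hσ h

theorem single_mem_filtration {S : Set X} {σ : Finset X} {k : ℕ} (h : (outer S σ).card ≤ k)
    (r : R) : Finsupp.single σ r ∈ filtration R S k :=
  Finsupp.single_mem_supported R r h

theorem supported_level_le_filtration (S : Set X) (P : Set (Finset X)) (n : ℕ) :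
    Finsupp.supported R R (level P n) ≤ filtration R S n :=
  Finsupp.supported_mono fun _ hσ => (Finset.card_le_card (outer_subset S _)).trans hσ.2.le

end
-- The boundary operator on formal sums.
variable {X : Type*} [LinearOrder X]

variable (R X) in
/-- The augmented simplicial boundary on formal sums of finite subsets of `X`. -/
noncomputable def boundary : (Finset X →₀ R) →ₗ[R] (Finset X →₀ R) :=
  Finsupp.linearCombination R fun σ =>
    ∑ x ∈ σ, Finsupp.single (σ.erase x) ((-1 : R) ^ position σ x)

theorem boundary_single_one (σ : Finset X) :
    boundary R X (Finsupp.single σ 1) =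
      ∑ x ∈ σ, Finsupp.single (σ.erase x) ((-1 : R) ^ position σ x) := by
  simp [boundary]

theorem boundary_single (σ : Finset X) (r : R) :
    boundary R X (Finsupp.single σ r) =
      ∑ x ∈ σ, Finsupp.single (σ.erase x) (r * (-1 : R) ^ position σ x) := by
  simp [boundary, Finset.smul_sum]

/-- Removing two elements in either order gives the same set with opposite signs. -/
theorem boundary_boundary (x : Finset X →₀ R) : boundary R X (boundary R X x) = 0 := by
  suffices boundary R X ∘ₗ boundary R X = 0 from LinearMap.congr_fun this x
  ext1 σ
  ext1
  simp only [LinearMap.comp_apply, Finsupp.lsingle_apply, LinearMap.zero_apply,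
    map_sum, boundary_single]
  rw [Finset.sum_sigma']
  refine Finset.sum_involution (fun a _ => ⟨a.2, a.1⟩) ?_ ?_ ?_ ?_
  · rintro ⟨x, y⟩ h
    simp only [Finset.mem_sigma, Finset.mem_erase] at h
    dsimp only
    rw [Finset.erase_right_comm, ← Finsupp.single_add, one_mul, one_mul,
      position_sign_cancel R σ h.1 h.2.2 h.2.1.symm, Finsupp.single_zero]
  · rintro ⟨x, y⟩ h - h'
    simp only [Finset.mem_sigma, Finset.mem_erase] at h
    exact h.2.1 (congrArg Sigma.fst h')
  · rintro ⟨x, y⟩ h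
    simp only [Finset.mem_sigma, Finset.mem_erase] at h ⊢
    exact ⟨h.2.2, h.2.1.symm, h.1⟩
  · rintro ⟨x, y⟩ -
    rfl

theorem boundary_mem_supported_level {P : Set (Finset X)} (hP : IsLowerSet P) {n : ℕ}
    {x : Finset X →₀ R} (hx : x ∈ Finsupp.supported R R (level P (n + 1))) :
    boundary R X x ∈ Finsupp.supported R R (level P n) := by
  refine Finsupp.map_mem_of_mem_supported _ (fun σ hσ => ?_) hx
  rw [boundary_single_one]
  refine Submodule.sum_mem _ fun y hy => Finsupp.single_mem_supported R _ ?_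
  refine ⟨hP (Finset.erase_subset y σ) hσ.1, ?_⟩
  rw [Finset.card_erase_of_mem hy, hσ.2, Nat.add_sub_cancel]

/-- The cycles of degree `p` of a family `P` of finite sets, for the unaugmented boundary. -/
noncomputable def cycles (R : Type*) [CommRing R] (P : Set (Finset X)) (p : ℕ) :
    Submodule R (Finset X →₀ R) :=
  Finsupp.supported R R (level P (p + 1)) ⊓ if p = 0 then ⊤ else LinearMap.ker (boundary R X)

/-- The boundaries of degree `p` of a family `P` of finite sets. -/
noncomputable def boundaries (R : Type*) [CommRing R] (P : Set (Finset X)) (p : ℕ) :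
    Submodule R (Finset X →₀ R) :=
  (Finsupp.supported R R (level P (p + 2))).map (boundary R X)

/-! ### Coning off the vertices outside of a set -/

theorem outer_erase_of_mem {S : Set X} (σ : Finset X) {x : X} (hx : x ∈ S) :
    outer S (σ.erase x) = outer S σ := by
  ext y
  simp only [mem_outer, Finset.mem_erase]
  grind

theorem outer_insert_of_mem {S : Set X} (σ : Finset X) {x : X} (hx : x ∈ S) :
    outer S (insert x σ) = outer S σ := by
  ext y
  simp only [mem_outer, Finset.mem_insert]
  grind

theorem card_outer_erase_lt {S : Set X} {σ : Finset X} {x : X} (hx : x ∈ σ) (hxS : x ∉ S) :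
    (outer S (σ.erase x)).card < (outer S σ).card := by
  refine Finset.card_lt_card ⟨fun y => ?_, fun h => ?_⟩
  · simp only [mem_outer, Finset.mem_erase]
    tauto
  · have := h (mem_outer.2 ⟨hx, hxS⟩)
    simp [mem_outer] at this

theorem boundary_mem_filtration {S : Set X} {k : ℕ} {x : Finset X →₀ R}
    (hx : x ∈ filtration R S k) : boundary R X x ∈ filtration R S k := by
  refine Finsupp.map_mem_of_mem_supported _ (fun σ hσ => ?_) hx
  rw [boundary_single_one]
  exact Submodule.sum_mem _ fun y _ => single_mem_filtration
    ((Finset.card_le_card (outer_mono S (Finset.erase_subset y σ))).trans hσ) _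

/-- `P` is closed under adding to a set, with nonempty part `a` outside of `S`, the apex `c a`,
which lies in `S`. -/
def IsApex (S : Set X) (P : Set (Finset X)) (c : Finset X → X) : Prop :=
  ∀ σ ∈ P, (outer S σ).Nonempty → c (outer S σ) ∈ S ∧ insert (c (outer S σ)) σ ∈ P

/-- `P` has an apex for every nonempty part outside of `S`. -/
def HasApices (S : Set X) (P : Set (Finset X)) : Prop :=
  ∀ a : Finset X, a.Nonempty → ∃ x, ∀ σ ∈ P, outer S σ = a → x ∈ S ∧ insert x σ ∈ P

theorem HasApices.exists_isApex [Nonempty X] {S : Set X} {P : Set (Finset X)}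
    (h : HasApices S P) : ∃ c, IsApex S P c := by
  choose! c hc using h
  exact ⟨c, fun σ hσ hne => hc _ hne σ hσ rfl⟩

open Classical in
variable (R) in
/-- The cone operator, which adds the apex `c a` to the sets with nonempty part `a` outside
of `S`. -/
noncomputable def cone (S : Set X) (c : Finset X → X) : (Finset X →₀ R) →ₗ[R] (Finset X →₀ R) :=
  Finsupp.linearCombination R fun σ =>
    -- The sign puts the apex in first place; a repeated apex gives a degenerate simplex, hence 0.
    if (outer S σ).Nonempty ∧ c (outer S σ) ∉ σ then
      Finsupp.single (insert (c (outer S σ)) σ)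
        ((-1 : R) ^ position (insert (c (outer S σ)) σ) (c (outer S σ)))
    else 0

open Classical in
theorem cone_single (S : Set X) (c : Finset X → X) (σ : Finset X) (r : R) :
    cone R S c (Finsupp.single σ r) =
      if (outer S σ).Nonempty ∧ c (outer S σ) ∉ σ then
        Finsupp.single (insert (c (outer S σ)) σ)
          (r * (-1 : R) ^ position (insert (c (outer S σ)) σ) (c (outer S σ)))
      else 0 := by
  simp only [cone, Finsupp.linearCombination_single]
  split_ifs <;> simp

variable {S : Set X} {P : Set (Finset X)} {c : Finset X → X}

theorem cone_single_mem_filtration (hc : IsApex S P c) {σ : Finset X} (hσ : σ ∈ P) {k : ℕ}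
    (hk : (outer S σ).card ≤ k) (r : R) : cone R S c (Finsupp.single σ r) ∈ filtration R S k := by
  rw [cone_single]
  split_ifs with h
  · refine single_mem_filtration ?_ _
    rwa [outer_insert_of_mem _ (hc σ hσ h.1).1]
  · exact Submodule.zero_mem _

theorem cone_mem_supported_level (hc : IsApex S P c) {n : ℕ} {x : Finset X →₀ R}
    (hx : x ∈ Finsupp.supported R R (level P n)) :
    cone R S c x ∈ Finsupp.supported R R (level P (n + 1)) := by
  refine Finsupp.map_mem_of_mem_supported _ (fun σ hσ => ?_) hx
  rw [cone_single]
  split_ifs with h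
  · refine Finsupp.single_mem_supported R _ ⟨(hc σ hσ.1 h.1).2, ?_⟩
    rw [Finset.card_insert_of_notMem h.2, hσ.2]
  · exact Submodule.zero_mem _

/-- Up to sets with fewer elements outside of `S`, the cone operator is a contracting homotopy. -/
theorem homotopy_single_mem_filtration (hP : IsLowerSet P) (hc : IsApex S P c) {σ : Finset X}
    (hσ : σ ∈ P) {k : ℕ} (hk : (outer S σ).card = k + 1) :
    boundary R X (cone R S c (Finsupp.single σ 1)) + cone R S c (boundary R X (Finsupp.single σ 1))
      - Finsupp.single σ 1 ∈ filtration R S k := by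
  have hne : (outer S σ).Nonempty := Finset.card_pos.1 (by omega)
  obtain ⟨hcS, hcP⟩ := hc σ hσ hne
  set a := c (outer S σ) with ha
  -- Removing `x ∉ S` may change the apex, but these terms are negligible, having fewer elements
  -- outside of `S`.
  have low : ∀ x ∈ σ, x ∉ S → ∀ r : R,
      cone R S c (Finsupp.single (σ.erase x) r) ∈ filtration R S k := fun x hx hxS r =>
    cone_single_mem_filtration hc (hP (Finset.erase_subset x σ) hσ)
      (by have := card_outer_erase_lt hx hxS; omega) r
  -- Removing `x ∈ S` keeps the apex, since it depends only on the part outside of `S`.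
  have inS : ∀ x ∈ S, ∀ r : R, cone R S c (Finsupp.single (σ.erase x) r) =
      if a ∉ σ.erase x then Finsupp.single (insert a (σ.erase x))
        (r * (-1 : R) ^ position (insert a (σ.erase x)) a) else 0 := fun x hx r => by
    rw [cone_single, outer_erase_of_mem σ hx, ← ha]
    simp [hne]
  rw [boundary_single_one, map_sum]
  -- If `a ∈ σ`, the face without `a` is coned back to `σ`, and the other faces with the same outer
  -- part are killed. If `a ∉ σ`, removing `a` from the cone gives `σ`, and the terms for `x ∈ S`
  -- cancel in pairs.
  by_cases haσ : a ∈ σ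
  · have h0 : cone R S c (Finsupp.single σ 1) = 0 := by
      rw [cone_single, if_neg (by rw [← ha]; tauto)]
    rw [h0, map_zero, zero_add, ← Finset.add_sum_erase _ _ haσ, inS a hcS,
      if_pos (Finset.notMem_erase a σ), Finset.insert_erase haσ, ← mul_pow, neg_mul_neg, one_mul,
      one_pow, add_sub_cancel_left]
    refine Submodule.sum_mem _ fun x hx => ?_
    by_cases hxS : x ∈ S
    · rw [inS x hxS, if_neg]
      · exact Submodule.zero_mem _
      · have := Finset.ne_of_mem_erase hx
        simp [haσ, this.symm]
    · exact low x (Finset.mem_of_mem_erase hx) hxS _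
  · have h0 : cone R S c (Finsupp.single σ 1) =
        Finsupp.single (insert a σ) ((-1 : R) ^ position (insert a σ) a) := by
      rw [cone_single, ← ha, if_pos ⟨hne, haσ⟩, one_mul]
    rw [h0, boundary_single, Finset.sum_insert haσ, Finset.erase_insert haσ, ← mul_pow,
      neg_mul_neg, one_mul, one_pow, add_assoc, add_sub_cancel_left, ← Finset.sum_add_distrib]
    refine Submodule.sum_mem _ fun x hx => ?_
    have hxa : a ≠ x := fun h => haσ (h ▸ hx)
    by_cases hxS : x ∈ S
    · rw [inS x hxS, if_pos (fun h => haσ (Finset.mem_of_mem_erase h)),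
        Finset.erase_insert_of_ne hxa, ← Finsupp.single_add]
      have := position_sign_cancel R (insert a σ) (Finset.mem_insert_self a σ)
        (Finset.mem_insert_of_mem hx) hxa
      rw [Finset.erase_insert haσ, Finset.erase_insert_of_ne hxa] at this
      -- Signs are their own inverses, so multiplying `this` by the signs of `x` in `insert a σ` and
      -- in `σ` yields the required cancellation.
      have sq : ∀ m : ℕ, (-1 : R) ^ m * (-1) ^ m = 1 := fun m => by
        rw [← mul_pow, neg_mul_neg, one_mul, one_pow]
      rw [show (-1 : R) ^ position (insert a σ) a * (-1) ^ position (insert a σ) x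
          + (-1) ^ position σ x * (-1) ^ position (insert a (σ.erase x)) a = 0 by
        linear_combination (-1 : R) ^ position (insert a σ) x * (-1) ^ position σ x * this
          - (-1 : R) ^ position (insert a σ) a * (-1) ^ position (insert a σ) x * sq (position σ x)
          - (-1 : R) ^ position σ x * (-1) ^ position (insert a (σ.erase x)) a
            * sq (position (insert a σ) x), Finsupp.single_zero]
      exact Submodule.zero_mem _
    · refine Submodule.add_mem _ (single_mem_filtration ?_ _) (low x hx hxS _)
      have := card_outer_erase_lt (S := S) (Finset.mem_insert_of_mem (b := a) hx) hxS
      rw [outer_insert_of_mem _ hcS] at this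
      omega

/-- With `C` the cone operator, `x - ∂Cx = C∂x - (∂C + C∂ - 1)x`. The first term is low because `∂x`
is and `C` preserves the filtration on members of `P`, the second by the homotopy formula. -/
theorem sub_boundary_cone_mem_filtration (hP : IsLowerSet P) (hc : IsApex S P c) {n k : ℕ}
    {x : Finset X →₀ R} (hx : x ∈ Finsupp.supported R R (level P (n + 1)))
    (hxk : x ∈ filtration R S (k + 1)) (hbx : boundary R X x ∈ filtration R S k) :
    x - boundary R X (cone R S c x) ∈ filtration R S k := by
  have h1 : cone R S c (boundary R X x) ∈ filtration R S k := by
    have : boundary R X x ∈ Finsupp.supported R R (level P n ∩ {σ | (outer S σ).card ≤ k}) := by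
      rw [Finsupp.supported_inter]
      exact ⟨boundary_mem_supported_level hP hx, hbx⟩
    exact Finsupp.map_mem_of_mem_supported _
      (fun σ hσ => cone_single_mem_filtration hc hσ.1.1 hσ.2 1) this
  have h2 : (boundary R X ∘ₗ cone R S c + cone R S c ∘ₗ boundary R X
      - (LinearMap.id : (Finset X →₀ R) →ₗ[R] _)) x
      ∈ filtration R S k := by
    have : x ∈ Finsupp.supported R R (level P (n + 1) ∩ {σ | (outer S σ).card ≤ k + 1}) := by
      rw [Finsupp.supported_inter]
      exact ⟨hx, hxk⟩
    refine Finsupp.map_mem_of_mem_supported _ (fun σ hσ => ?_) this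
    rcases Nat.lt_or_ge k (outer S σ).card with h | h
    · exact homotopy_single_mem_filtration hP hc hσ.1.1 (le_antisymm hσ.2 h)
    · refine Submodule.sub_mem _ (Submodule.add_mem _ (boundary_mem_filtration
        (cone_single_mem_filtration hc hσ.1.1 h 1)) ?_) (single_mem_filtration h 1)
      rw [LinearMap.comp_apply, boundary_single_one, map_sum]
      exact Submodule.sum_mem _ fun y _ => cone_single_mem_filtration hc
        (hP (Finset.erase_subset y σ) hσ.1.1)
        ((Finset.card_le_card (outer_mono S (Finset.erase_subset y σ))).trans h) _
  have := Submodule.sub_mem _ h1 h2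
  convert this using 1
  simp only [LinearMap.sub_apply, LinearMap.add_apply, LinearMap.comp_apply, LinearMap.id_apply]
  abel

/-- A formal sum of members of `P` whose boundary lives in `S` is a boundary up to a formal sum of
subsets of `S`. -/
theorem exists_sub_boundary_mem_filtration_zero (hP : IsLowerSet P) (hc : HasApices S P) {n k : ℕ}
    {x : Finset X →₀ R} (hx : x ∈ Finsupp.supported R R (level P (n + 1)))
    (hxk : x ∈ filtration R S k) (hbx : boundary R X x ∈ filtration R S 0) :
    ∃ y ∈ Finsupp.supported R R (level P (n + 2)), x - boundary R X y ∈ filtration R S 0 := by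
  -- Turning the apices into a function on all finite sets, including the empty one, needs a default
  -- value in `X`.
  rcases isEmpty_or_nonempty X with hX | hX
  · refine ⟨0, Submodule.zero_mem _, ?_⟩
    rw [map_zero, sub_zero]
    refine Finsupp.supported_mono (fun σ _ => ?_) hxk
    simp [Finset.eq_empty_of_isEmpty (outer S σ)]
  obtain ⟨c, hc⟩ := hc.exists_isApex
  induction k generalizing x with
  | zero => exact ⟨0, Submodule.zero_mem _, by simpa using hxk⟩
  | succ k ih =>
    have hcone := cone_mem_supported_level hc hx
    -- The corrected chain `x - ∂Cx` still has boundary `∂x`, so the induction continues.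
    obtain ⟨y, hy, hxy⟩ := ih
      (Submodule.sub_mem _ hx (boundary_mem_supported_level hP hcone))
      (sub_boundary_cone_mem_filtration hP hc hx hxk (filtration_mono S (Nat.zero_le k) hbx))
      (by rwa [map_sub, boundary_boundary, sub_zero])
    exact ⟨cone R S c x + y, Submodule.add_mem _ hcone hy, by rwa [map_add, ← sub_sub]⟩

/-! ### Chains of a complex as formal sums of finite sets -/

section Embedding

variable {Y : Type*} [LinearOrder Y] (f : Y ↪o X) (L : PreAbstractSimplicialComplex Y)

variable (R) in
/-- The formal sum of finite subsets of `X` given by a chain of a complex on `Y`. -/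
noncomputable def ofChain (p : ℕ) : L.Chain R p →ₗ[R] (Finset X →₀ R) :=
  Finsupp.lmapDomain R R fun σ => σ.1.map f.toEmbedding

theorem ofChain_single {p : ℕ} (σ : L.Simplex p) (r : R) :
    ofChain R f L p (Finsupp.single σ r) = Finsupp.single (σ.1.map f.toEmbedding) r :=
  Finsupp.mapDomain_single

theorem ofChain_injective (p : ℕ) : Function.Injective (ofChain R f L p) :=
  Finsupp.mapDomain_injective fun _ _ h => Subtype.ext (Finset.map_injective _ h)

theorem position_map (σ : Finset Y) (y : Y) :
    position (σ.map f.toEmbedding) (f y) = position σ y := by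
  rw [position, Finset.filter_map, Finset.card_map, position]
  congr 1
  ext z
  simp

/-- An order embedding preserves positions, hence signs. -/
theorem boundary_ofChain (p : ℕ) (x : L.Chain R (p + 1)) :
    boundary R X (ofChain R f L (p + 1) x) =
      ofChain R f L p (PreAbstractSimplicialComplex.boundary R L p x) := by
  suffices boundary R X ∘ₗ ofChain R f L (p + 1) =
      ofChain R f L p ∘ₗ PreAbstractSimplicialComplex.boundary R L p from
    LinearMap.congr_fun this x
  ext1 σ
  ext1
  simp only [LinearMap.comp_apply, Finsupp.lsingle_apply, ofChain_single, boundary_single_one,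
    PreAbstractSimplicialComplex.boundary, Finsupp.linearCombination_single, one_smul,
    simplexBoundary, map_sum, Finset.sum_map]
  rw [← Finset.sum_coe_sort]
  refine Finset.sum_congr rfl fun y _ => ?_
  congr 1
  · exact (Finset.map_erase f.toEmbedding σ.1 y).symm
  · rw [← position_map f]
    rfl

variable {f L}

theorem ofChain_mem_supported_level
    (hL : ∀ σ : Finset Y, σ.Nonempty → (σ.map f.toEmbedding ∈ P ↔ σ ∈ L.faces)) {p : ℕ}
    (x : L.Chain R p) : ofChain R f L p x ∈ Finsupp.supported R R (level P (p + 1)) := by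
  refine Finsupp.map_mem_of_mem_supported (s := Set.univ) _ (fun σ _ => ?_) (by simp)
  rw [ofChain_single]
  refine Finsupp.single_mem_supported R _ ⟨?_, ?_⟩
  · exact (hL σ.1 (Finset.card_pos.1 (by have := σ.2.2; omega))).2 σ.2.1
  · rw [Finset.card_map, σ.2.2]

theorem ofChain_mem_filtration_zero {p : ℕ} (x : L.Chain R p) :
    ofChain R f L p x ∈ filtration R (Set.range f) 0 := by
  refine Finsupp.map_mem_of_mem_supported (s := Set.univ) _ (fun σ _ => ?_) (by simp)
  rw [ofChain_single]
  refine single_mem_filtration ?_ _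
  rw [Nat.le_zero, Finset.card_eq_zero, Finset.eq_empty_iff_forall_notMem]
  intro x hx
  simp only [mem_outer, Finset.mem_map, Set.mem_range, not_exists] at hx
  obtain ⟨⟨y, -, hy⟩, h⟩ := hx
  exact h y hy

theorem exists_ofChain_eq
    (hL : ∀ σ : Finset Y, σ.Nonempty → (σ.map f.toEmbedding ∈ P ↔ σ ∈ L.faces)) {p : ℕ}
    {x : Finset X →₀ R} (hx : x ∈ Finsupp.supported R R (level P (p + 1)))
    (hx0 : x ∈ filtration R (Set.range f) 0) : ∃ z, ofChain R f L p z = x := by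
  have : x ∈ Finsupp.supported R R
      (level P (p + 1) ∩ {σ | (outer (Set.range f) σ).card ≤ 0}) := by
    rw [Finsupp.supported_inter]
    exact ⟨hx, hx0⟩
  refine Finsupp.map_mem_of_mem_supported (N := LinearMap.range (ofChain R f L p)) LinearMap.id
    (fun σ hσ => ?_) this
  obtain ⟨⟨hσP, hcard⟩, hσ0⟩ := hσ
  have hsub : (σ : Set X) ⊆ Set.range f := fun x hx => by
    by_contra h
    have : x ∈ outer (Set.range f) σ := mem_outer.2 ⟨hx, h⟩
    rw [Finset.card_eq_zero.1 (Nat.le_zero.1 hσ0)] at this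
    exact Finset.notMem_empty _ this
  obtain ⟨τ, rfl⟩ : ∃ τ : Finset Y, τ.map f.toEmbedding = σ := by
    rw [← Set.image_univ] at hsub
    obtain ⟨τ, -, h⟩ := Finset.subset_set_image_iff.1 hsub
    exact ⟨τ, by rw [Finset.map_eq_image]; exact h⟩
  rw [Finset.card_map] at hcard
  exact ⟨Finsupp.single ⟨τ, (hL τ (Finset.card_pos.1 (by omega))).1 hσP, hcard⟩ 1,
    ofChain_single _ _ _ _⟩

/-! ### Homology of a restriction. -/

/-- If the vertices outside of the range of `f` can be coned off in `P`, then the restriction `L`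
of `P` along `f` has the homology of `P`. -/
theorem nonempty_homology_equiv (R : Type*) [CommRing R] (hP : IsLowerSet P)
    (hL : ∀ σ : Finset Y, σ.Nonempty → (σ.map f.toEmbedding ∈ P ↔ σ ∈ L.faces))
    (hc : HasApices (Set.range f) P) (p : ℕ) :
    Nonempty (L.Homology R p ≃ₗ[R] Submodule.Subquotient (cycles R P p) (boundaries R P p)) := by
  refine Submodule.nonempty_subquotient_equiv (ofChain R f L p) (fun z hz => ?_) (fun z hz => ?_)
    fun x hx => ?_
  · refine ⟨ofChain_mem_supported_level hL z, ?_⟩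
    cases p with
    | zero => simp
    | succ p =>
      have hz : PreAbstractSimplicialComplex.boundary R L p z = 0 := hz
      simp [boundary_ofChain, hz]
  · constructor
    · rintro ⟨w, rfl⟩
      exact ⟨ofChain R f L (p + 1) w, ofChain_mem_supported_level hL w, boundary_ofChain f L p w⟩
    · rintro ⟨w, hw, hwz⟩
      -- The bounding chain `w` has its boundary in `S`, so `w - ∂y` is a chain of `L` with the same
      -- boundary.
      obtain ⟨y, hy, hwy⟩ := exists_sub_boundary_mem_filtration_zero hP hc hw
        (supported_level_le_filtration _ _ _ hw) (hwz ▸ ofChain_mem_filtration_zero z)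
      obtain ⟨u, hu⟩ := exists_ofChain_eq hL
        (Submodule.sub_mem _ hw (boundary_mem_supported_level hP hy)) hwy
      refine ⟨u, ofChain_injective f L p ?_⟩
      rw [← boundary_ofChain, hu, map_sub, boundary_boundary, sub_zero, hwz]
  · obtain ⟨hx, hbx⟩ := hx
    have hbx0 : boundary R X x ∈ filtration R (Set.range f) 0 := by
      cases p with
      -- In degree 0 the augmented boundary need not vanish, but it is a multiple of the empty set.
      | zero => exact supported_level_le_filtration _ _ _ (boundary_mem_supported_level hP hx)
      | succ p =>
        rw [if_neg p.succ_ne_zero] at hbx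
        rw [LinearMap.mem_ker.1 hbx]
        exact Submodule.zero_mem _
    obtain ⟨y, hy, hxy⟩ := exists_sub_boundary_mem_filtration_zero hP hc hx
      (supported_level_le_filtration _ _ _ hx) hbx0
    obtain ⟨z, hz⟩ := exists_ofChain_eq hL
      (Submodule.sub_mem _ hx (boundary_mem_supported_level hP hy)) hxy
    refine ⟨z, ?_, y, hy, by rw [hz, sub_sub_cancel]⟩
    cases p with
    | zero => exact Submodule.mem_top
    | succ p =>
      rw [if_neg p.succ_ne_zero] at hbx
      refine LinearMap.mem_ker.2 (ofChain_injective f L p ?_)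
      rw [← boundary_ofChain, hz, map_sub, boundary_boundary, LinearMap.mem_ker.1 hbx, sub_zero,
        map_zero]

end Embedding

end FinsetChain

/-! ### The incidence complex of a hypergraph -/

namespace IndexedHypergraph

variable {V E : Type*} (H : IndexedHypergraph V E)

/-- The finite sets of vertices and hyperedges in which all the vertices are incident to all the
hyperedges, the vertices lie in a common hyperedge (if there are any), and the hyperedges have a
common vertex (if there are any). -/
def incidence : Set (Finset (V ⊕ₗ E)) :=
  {σ | (∀ v e, Sum.inlₗ v ∈ σ → Sum.inrₗ e ∈ σ → v ∈ H.edge e) ∧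
    ((∃ v, Sum.inlₗ v ∈ σ) → ∃ e, ∀ v, Sum.inlₗ v ∈ σ → v ∈ H.edge e) ∧
    ((∃ e, Sum.inrₗ e ∈ σ) → ∃ v, ∀ e, Sum.inrₗ e ∈ σ → v ∈ H.edge e)}

theorem isLowerSet_incidence : IsLowerSet H.incidence := by
  rintro σ τ hτσ ⟨h1, h2, h3⟩
  refine ⟨fun v e hv he => h1 v e (hτσ hv) (hτσ he), fun ⟨v, hv⟩ => ?_, fun ⟨e, he⟩ => ?_⟩
  · obtain ⟨e, he⟩ := h2 ⟨v, hτσ hv⟩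
    exact ⟨e, fun w hw => he w (hτσ hw)⟩
  · obtain ⟨v, hv⟩ := h3 ⟨e, hτσ he⟩
    exact ⟨v, fun w hw => hv w (hτσ hw)⟩

variable [LinearOrder V] [LinearOrder E]

/-! ### Vertices and hyperedges inside `V ⊕ₗ E`. -/

variable (V E) in
/-- The vertices, as elements of `V ⊕ₗ E`. -/
def inlEmbedding : V ↪o V ⊕ₗ E :=
  OrderEmbedding.ofMapLEIff Sum.inlₗ fun _ _ => Sum.Lex.inl_le_inl_iff

variable (V E) in
/-- The hyperedges, as elements of `V ⊕ₗ E`. -/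
def inrEmbedding : E ↪o V ⊕ₗ E :=
  OrderEmbedding.ofMapLEIff Sum.inrₗ fun _ _ => Sum.Lex.inr_le_inr_iff

theorem inl_mem_map_inl {σ : Finset V} {v : V} :
    Sum.inlₗ v ∈ σ.map (inlEmbedding V E).toEmbedding ↔ v ∈ σ :=
  Finset.mem_map' (inlEmbedding V E).toEmbedding

theorem inr_notMem_map_inl {σ : Finset V} {e : E} :
    Sum.inrₗ e ∉ σ.map (inlEmbedding V E).toEmbedding := by
  rw [Finset.mem_map]
  rintro ⟨v, -, h⟩
  exact Sum.inl_ne_inr (toLex.injective h)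

theorem inr_mem_map_inr {σ : Finset E} {e : E} :
    Sum.inrₗ e ∈ σ.map (inrEmbedding V E).toEmbedding ↔ e ∈ σ :=
  Finset.mem_map' (inrEmbedding V E).toEmbedding

theorem inl_notMem_map_inr {σ : Finset E} {v : V} :
    Sum.inlₗ v ∉ σ.map (inrEmbedding V E).toEmbedding := by
  rw [Finset.mem_map]
  rintro ⟨e, -, h⟩
  exact Sum.inr_ne_inl (toLex.injective h)

/-- Without hyperedges, only the second condition of `incidence` has content. -/
theorem map_inlEmbedding_mem_incidence {σ : Finset V} (hσ : σ.Nonempty) :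
    σ.map (inlEmbedding V E).toEmbedding ∈ H.incidence ↔ σ ∈ H.upperClosure.faces := by
  have hne : ∃ v, v ∈ σ := hσ
  simp only [incidence, Set.mem_ofPred_eq, inl_mem_map_inl, inr_notMem_map_inl, hne, forall_const,
    upperClosure]
  simp [hσ, Set.subset_def]

theorem map_inrEmbedding_mem_incidence {σ : Finset E} (hσ : σ.Nonempty) :
    σ.map (inrEmbedding V E).toEmbedding ∈ H.incidence ↔ σ ∈ H.nerve.faces := by
  have hne : ∃ e, e ∈ σ := hσ
  simp only [incidence, Set.mem_ofPred_eq, inr_mem_map_inr, inl_notMem_map_inr, hne, forall_const,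
    nerve]
  simp [hσ, Set.Nonempty]

theorem inl_mem_insert_inl {σ : Finset (V ⊕ₗ E)} {v w : V} :
    Sum.inlₗ w ∈ insert (Sum.inlₗ v) σ ↔ w = v ∨ Sum.inlₗ w ∈ σ :=
  Finset.mem_insert.trans (or_congr_left (inlEmbedding V E).injective.eq_iff)

theorem inr_mem_insert_inl {σ : Finset (V ⊕ₗ E)} {v : V} {f : E} :
    Sum.inrₗ f ∈ insert (Sum.inlₗ v) σ ↔ Sum.inrₗ f ∈ σ :=
  Finset.mem_insert.trans (or_iff_right fun h => Sum.inr_ne_inl (toLex.injective h))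

theorem inr_mem_insert_inr {σ : Finset (V ⊕ₗ E)} {e f : E} :
    Sum.inrₗ f ∈ insert (Sum.inrₗ e) σ ↔ f = e ∨ Sum.inrₗ f ∈ σ :=
  Finset.mem_insert.trans (or_congr_left (inrEmbedding V E).injective.eq_iff)

theorem inl_mem_insert_inr {σ : Finset (V ⊕ₗ E)} {w : V} {e : E} :
    Sum.inlₗ w ∈ insert (Sum.inrₗ e) σ ↔ Sum.inlₗ w ∈ σ :=
  Finset.mem_insert.trans (or_iff_right fun h => Sum.inl_ne_inr (toLex.injective h))

theorem inr_mem_outer_inl {σ : Finset (V ⊕ₗ E)} {e : E} :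
    Sum.inrₗ e ∈ FinsetChain.outer (Set.range (inlEmbedding V E)) σ ↔ Sum.inrₗ e ∈ σ := by
  refine FinsetChain.mem_outer.trans (and_iff_left ?_)
  rintro ⟨v, h⟩
  exact Sum.inl_ne_inr (toLex.injective h)

theorem inl_mem_outer_inr {σ : Finset (V ⊕ₗ E)} {v : V} :
    Sum.inlₗ v ∈ FinsetChain.outer (Set.range (inrEmbedding V E)) σ ↔ Sum.inlₗ v ∈ σ := by
  refine FinsetChain.mem_outer.trans (and_iff_left ?_)
  rintro ⟨e, h⟩
  exact Sum.inr_ne_inl (toLex.injective h)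

theorem exists_inr_mem {σ : Finset (V ⊕ₗ E)}
    (h : (FinsetChain.outer (Set.range (inlEmbedding V E)) σ).Nonempty) :
    ∃ e, Sum.inrₗ e ∈ σ := by
  obtain ⟨x, hx⟩ := h
  obtain ⟨hx, hx'⟩ := FinsetChain.mem_outer.1 hx
  rcases h : ofLex x with w | e
  · exact absurd ⟨w, congrArg toLex h.symm⟩ hx'
  · obtain rfl : x = Sum.inrₗ e := h
    exact ⟨e, hx⟩

theorem exists_inl_mem {σ : Finset (V ⊕ₗ E)}
    (h : (FinsetChain.outer (Set.range (inrEmbedding V E)) σ).Nonempty) :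
    ∃ v, Sum.inlₗ v ∈ σ := by
  obtain ⟨x, hx⟩ := h
  obtain ⟨hx, hx'⟩ := FinsetChain.mem_outer.1 hx
  rcases h : ofLex x with w | e
  · obtain rfl : x = Sum.inlₗ w := h
    exact ⟨w, hx⟩
  · exact absurd ⟨e, congrArg toLex h.symm⟩ hx'

/-- The outer part is the set of hyperedges; the apex is a common vertex of them, which serves every
member with these hyperedges. -/
theorem hasApices_range_inlEmbedding :
    FinsetChain.HasApices (Set.range (inlEmbedding V E)) H.incidence := by
  intro a ha
  by_cases hex : ∃ σ ∈ H.incidence, FinsetChain.outer (Set.range (inlEmbedding V E)) σ = a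
  · obtain ⟨σ, ⟨-, -, h3⟩, rfl⟩ := hex
    obtain ⟨e, he⟩ := exists_inr_mem ha
    obtain ⟨v, hv⟩ := h3 ⟨e, he⟩
    refine ⟨Sum.inlₗ v, fun τ ⟨h1, _, _⟩ hτ => ⟨⟨v, rfl⟩, ?_⟩⟩
    have hiff : ∀ f : E, Sum.inrₗ f ∈ τ ↔ Sum.inrₗ f ∈ σ := fun f => by
      rw [← inr_mem_outer_inl, hτ, inr_mem_outer_inl]
    have hvτ : ∀ f, Sum.inrₗ f ∈ τ → v ∈ H.edge f := fun f hf => hv f ((hiff f).1 hf)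
    have h1' : ∀ w f, w = v ∨ Sum.inlₗ w ∈ τ → Sum.inrₗ f ∈ τ → w ∈ H.edge f := by
      rintro w f (rfl | hw) hf
      exacts [hvτ f hf, h1 w f hw hf]
    exact ⟨fun w f hw hf => h1' w f (inl_mem_insert_inl.1 hw) (inr_mem_insert_inl.1 hf),
      -- Any hyperedge of `τ` contains all the vertices of `τ` and also `v`.
      fun _ => ⟨e, fun w hw => h1' w e (inl_mem_insert_inl.1 hw) ((hiff e).2 he)⟩,
      fun _ => ⟨v, fun f hf => hvτ f (inr_mem_insert_inl.1 hf)⟩⟩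
  -- If `a` is not the outer part of a member, any element will do.
  · exact ⟨ha.choose, fun σ hσ h => absurd ⟨σ, hσ, h⟩ hex⟩

/-- Dually, the apex is a hyperedge containing all the vertices of the outer part. -/
theorem hasApices_range_inrEmbedding :
    FinsetChain.HasApices (Set.range (inrEmbedding V E)) H.incidence := by
  intro a ha
  by_cases hex : ∃ σ ∈ H.incidence, FinsetChain.outer (Set.range (inrEmbedding V E)) σ = a
  · obtain ⟨σ, ⟨-, h2, -⟩, rfl⟩ := hex
    obtain ⟨v, hv⟩ := exists_inl_mem ha
    obtain ⟨e, he⟩ := h2 ⟨v, hv⟩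
    refine ⟨Sum.inrₗ e, fun τ ⟨h1, _, _⟩ hτ => ⟨⟨e, rfl⟩, ?_⟩⟩
    have hiff : ∀ w : V, Sum.inlₗ w ∈ τ ↔ Sum.inlₗ w ∈ σ := fun w => by
      rw [← inl_mem_outer_inr, hτ, inl_mem_outer_inr]
    have heτ : ∀ w, Sum.inlₗ w ∈ τ → w ∈ H.edge e := fun w hw => he w ((hiff w).1 hw)
    have h1' : ∀ w f, Sum.inlₗ w ∈ τ → f = e ∨ Sum.inrₗ f ∈ τ → w ∈ H.edge f := by
      rintro w f hw (rfl | hf)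
      exacts [heτ w hw, h1 w f hw hf]
    exact ⟨fun w f hw hf => h1' w f (inl_mem_insert_inr.1 hw) (inr_mem_insert_inr.1 hf),
      fun _ => ⟨e, fun w hw => heτ w (inl_mem_insert_inr.1 hw)⟩,
      fun _ => ⟨v, fun f hf => h1' v f ((hiff v).2 hv) (inr_mem_insert_inr.1 hf)⟩⟩
  · exact ⟨ha.choose, fun σ hσ h => absurd ⟨σ, hσ, h⟩ hex⟩

end IndexedHypergraph

theorem mainTheorem4 {𝕂 : Type*} [Field 𝕂] {V E : Type*} [LinearOrder V] [LinearOrder E]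
    (H : IndexedHypergraph V E) (p : ℕ) :
    Nonempty (H.ClosureHomology 𝕂 p ≃ₗ[𝕂] H.nerve.Homology 𝕂 p) := by
  obtain ⟨f⟩ := FinsetChain.nonempty_homology_equiv 𝕂 H.isLowerSet_incidence
    (fun _ h => H.map_inlEmbedding_mem_incidence h)
    H.hasApices_range_inlEmbedding p
  obtain ⟨g⟩ := FinsetChain.nonempty_homology_equiv 𝕂 H.isLowerSet_incidence
    (fun _ h => H.map_inrEmbedding_mem_incidence h)
    H.hasApices_range_inrEmbedding p
  exact ⟨f.trans g.symm⟩
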